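/- Notation. For $A\in\mathbb R^{n\times n}$ and $1\le k\le n$, $A^{(k)}$ denotes the $k$th multiplicative compound of $A$, i.e. the $\binom nk\times\binom nk$ matrix of all minors of order $k$ of $A$, rows and columns being labelled by the increasing sequences of length $k$ in $\{1,\dots,n\}$, and $A^{[k]}:=\frac{d}{d\varepsilon}(I_n+\varepsilon A)^{(k)}|_{\varepsilon=0}$ its $k$th additive compound. For an invertible matrix $H$, $|z|_{2,H}:=|Hz|_2$, with induced matrix norm $\|M\|_{2,H}:=\max_{|z|_{2,H}=1}|Mz|_{2,H}$ and induced matrix measure $\mu_{2,H}(M):=\lim_{\varepsilon\downarrow0}(\|I+\varepsilon M\|_{2,H}-1)/\varepsilon$. For symmetric $S\in\mathbb R^{n\times n}$, $\lambda_1(S)\ge\dots\ge\lambda_n(S)$ are its eigenvalues. A system $\dot x=f(t,x)$, $t\ge 0$, $x\in\mathbb R^n$, with flow $\varphi$ (so that $\varphi(t,t_0,a)$ is the value at time $t$ of the solution with value $a$ at time $t_0$) is $k$-contractive with rate $\eta>0$ with respect to a norm $|\cdot|$ on $\mathbb R^{\binom nk}$ if, for all $0\le t_0\le t$ and all $a$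 such that the solutions starting at time $t_0$ from the points near $a$ exist up to time $t$, the map $\varphi(t,t_0,\cdot)$ is differentiable at $a$ and $|(\partial_a\varphi(t,t_0,a))^{(k)}z|\le e^{-\eta(t-t_0)}|z|$ for all $z\in\mathbb R^{\binom nk}$. Theorem. Consider the Lurie system $\dot x=Ax-B\Phi(t,Cx)$, where $A\in\mathbb R^{n\times n}$, $B\in\mathbb R^{n\times m}$, $C\in\mathbb R^{q\times n}$, and $\Phi:[0,\infty)\times\mathbb R^q\to\mathbb R^m$ is continuous and has a Jacobian $J_\Phi(t,y)=\frac{\partial\Phi}{\partial y}(t,y)$ that is continuous in $(t,y)$. Let $J(t,x):=A-BJ_\Phi(t,Cx)C$ be the Jacobian of the system. Fix $k\in\{1,\dots,n\}$. Suppose that $\eta_1,\eta_2\in\mathbb R$ and $P=QQ$ with $Q\in\mathbb R^{n\times n}$ symmetric positive definite satisfy $$P^{(k)}A^{[k]}+(A^{[k]})^TP^{(k)}+\eta_1P^{(k)}+Q^{(k)}\left((QBB^TQ)^{[k]}+(Q^{-1}C^TCQ^{-1})^{[k]}\right)Q^{(k)}\preceq0$$ and $$\sum_{i=1}^k\lambda_i\left(Q^{-1}C^T\left(J_\Phi^T(t,y)J_\Phi(t,y)-I_q\right)CQ^{-1}\right)\le-\eta_2\quad\text{for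 all }t\ge0,\ y\in\mathbb R^q.$$ Then $$\mu_{2,Q^{(k)}}\left(J^{[k]}(t,x)\right)\le-\frac{\eta_1+\eta_2}{2}\quad\text{for all }t\ge0,\ x\in\mathbb R^n.$$ In particular, if $\eta_1+\eta_2>0$, then the system is $k$-contractive with rate $(\eta_1+\eta_2)/2$ with respect to the norm $|z|_{2,Q^{(k)}}=|Q^{(k)}z|_2$. -/

import Mathlib

open Matrix Filter Topology

noncomputable section

namespace Lurie

/-- The increasing sequences of length `k` in `{0, …, n-1}`, given by their sets of values.
They label the rows and columns of the `k`-th compounds. -/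
abbrev KSub (k n : ℕ) : Type := {s : Finset (Fin n) // s.card = k}

/-- The `k`-th multiplicative compound: the matrix of all minors of order `k`. -/
def mulCompound {n p : ℕ} (k : ℕ) (A : Matrix (Fin n) (Fin p) ℝ) :
    Matrix (KSub k n) (KSub k p) ℝ :=
  Matrix.of fun α β =>
    (A.submatrix (α.1.orderEmbOfFin α.2) (β.1.orderEmbOfFin β.2)).det

/-- The `k`-th additive compound: the (entrywise) derivative of `(I + ε A)^{(k)}` at `ε = 0`. -/
def addCompound {n : ℕ} (k : ℕ) (A : Matrix (Fin n) (Fin n) ℝ) :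
    Matrix (KSub k n) (KSub k n) ℝ :=
  Matrix.of fun α β => deriv (fun ε : ℝ => mulCompound k (1 + ε • A) α β) 0

/-- The `L₂` norm `(zᵀ z)^{1/2}`. -/
def l2Norm {ι : Type} [Fintype ι] (z : ι → ℝ) : ℝ := Real.sqrt (z ⬝ᵥ z)

/-- The scaled `L₂` norm `|z|_{2,H} = |H z|_2`. -/
def scaledNorm {ι : Type} [Fintype ι] (H : Matrix ι ι ℝ) (z : ι → ℝ) : ℝ := l2Norm (H *ᵥ z)

/-- The matrix norm induced by the vector norm `N`. -/
def inducedNorm {ι : Type} [Fintype ι] (N : (ι → ℝ) → ℝ) (A : Matrix ι ι ℝ) : ℝ :=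
  sSup {r : ℝ | ∃ z : ι → ℝ, N z = 1 ∧ r = N (A *ᵥ z)}

/-- `m` is the matrix measure (logarithmic norm) of `A` induced by the vector norm `N`. -/
def IsMatrixMeasure {ι : Type} [Fintype ι] [DecidableEq ι] (N : (ι → ℝ) → ℝ)
    (A : Matrix ι ι ℝ) (m : ℝ) : Prop :=
  Tendsto (fun ε : ℝ => (inducedNorm N (1 + ε • A) - 1) / ε) (𝓝[>] 0) (𝓝 m)

/-- The Jacobian matrix of `g : ℝᵖ → ℝʳ` at `x`. -/
def jacobian {p r : ℕ} (g : (Fin p → ℝ) → (Fin r → ℝ)) (x : Fin p → ℝ) :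
    Matrix (Fin r) (Fin p) ℝ :=
  LinearMap.toMatrix' (fderiv ℝ g x : (Fin p → ℝ) →ₗ[ℝ] (Fin r → ℝ))

/-- The closed-loop vector field `f(t,x) = A x - B Φ(t, C x)`. -/
def closedLoop {n m q : ℕ} (A : Matrix (Fin n) (Fin n) ℝ) (B : Matrix (Fin n) (Fin m) ℝ)
    (C : Matrix (Fin q) (Fin n) ℝ) (Φ : ℝ → (Fin q → ℝ) → (Fin m → ℝ))
    (t : ℝ) (x : Fin n → ℝ) : Fin n → ℝ :=
  A *ᵥ x - B *ᵥ Φ t (C *ᵥ x)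

/-- `Φ` is continuous on `[0,∞) × ℝ^q` and continuously differentiable in its second argument. -/
def IsContDiffInState {m q : ℕ} (Φ : ℝ → (Fin q → ℝ) → (Fin m → ℝ)) : Prop :=
  ContinuousOn (fun p : ℝ × (Fin q → ℝ) => Φ p.1 p.2) (Set.Ici 0 ×ˢ Set.univ) ∧
  (∀ t : ℝ, 0 ≤ t → Differentiable ℝ (Φ t)) ∧
  ContinuousOn (fun p : ℝ × (Fin q → ℝ) => fderiv ℝ (Φ p.1) p.2) (Set.Ici 0 ×ˢ Set.univ)

/-- `x` solves `ẋ = f(t,x)` on `[t₀, t₁]`. -/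
def IsSolution {n : ℕ} (f : ℝ → (Fin n → ℝ) → (Fin n → ℝ)) (t₀ t₁ : ℝ)
    (x : ℝ → (Fin n → ℝ)) : Prop :=
  ∀ t ∈ Set.Icc t₀ t₁, HasDerivWithinAt x (f t (x t)) (Set.Icc t₀ t₁) t

/-- The system `ẋ = f(t,x)`, `t ≥ 0`, is `k`-contractive with rate `η > 0` with respect to the
norm `N`: its flow is differentiable, and the `k`-th exterior power of the tangent map of the flow
contracts the `k`-vectors `z` (in particular `v₁ ∧ ⋯ ∧ v_k`, whose norm measures the volume of the
parallelotope spanned by the tangent vectors `v₁, …, v_k`) at the exponential rate `η`.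
Here `φ t a` is the value at time `t` of the solution that starts at time `t₀` from `a`,
and `jacobian (φ t) x₀` is the tangent map of the flow. -/
def IsKContractive {n : ℕ} (f : ℝ → (Fin n → ℝ) → (Fin n → ℝ)) (k : ℕ) (η : ℝ)
    (N : (KSub k n → ℝ) → ℝ) : Prop :=
  0 < η ∧
  ∀ (t₀ t₁ : ℝ), 0 ≤ t₀ → t₀ ≤ t₁ →
  ∀ (φ : ℝ → (Fin n → ℝ) → (Fin n → ℝ)) (x₀ : Fin n → ℝ),
    (∀ᶠ a in 𝓝 x₀, φ t₀ a = a ∧ IsSolution f t₀ t₁ (fun t => φ t a)) →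
    ∀ t ∈ Set.Icc t₀ t₁,
      DifferentiableAt ℝ (φ t) x₀ ∧
      ∀ z : KSub k n → ℝ,
        N (mulCompound k (jacobian (φ t) x₀) *ᵥ z) ≤ Real.exp (-η * (t - t₀)) * N z

/-- The sum `λ₁(S) + ⋯ + λ_k(S)` of the `k` largest eigenvalues (with multiplicity) of a
symmetric matrix `S`; `eigenvalues₀` lists the eigenvalues in decreasing order. -/
def sumLargestEigenvalues {n : ℕ} (k : ℕ) (S : Matrix (Fin n) (Fin n) ℝ) (hS : S.IsHermitian) :
    ℝ :=
  ∑ i : Fin (Fintype.card (Fin n)) with i.1 < k, hS.eigenvalues₀ i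

/-- The matrix `Q⁻¹ Cᵀ (Jᵀ J - I) C Q⁻¹`. -/
def gainMatrix {n m q : ℕ} (Q : Matrix (Fin n) (Fin n) ℝ) (C : Matrix (Fin q) (Fin n) ℝ)
    (J : Matrix (Fin m) (Fin q) ℝ) : Matrix (Fin n) (Fin n) ℝ :=
  Q⁻¹ * Cᵀ * (Jᵀ * J - 1) * C * Q⁻¹

theorem gainMatrix_isHermitian {n m q : ℕ} {Q : Matrix (Fin n) (Fin n) ℝ} (hQ : Q.PosDef)
    (C : Matrix (Fin q) (Fin n) ℝ) (J : Matrix (Fin m) (Fin q) ℝ) :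
    (gainMatrix Q C J).IsHermitian := by
  have h : Qᵀ = Q := by simpa using hQ.1.eq
  have h2 : (Q⁻¹)ᵀ = Q⁻¹ := by rw [Matrix.transpose_nonsing_inv, h]
  unfold Matrix.IsHermitian gainMatrix
  simp [Matrix.conjTranspose_eq_transpose_of_trivial, Matrix.transpose_mul,
    h2, Matrix.mul_assoc]

end Lurie

end

/-!
The tangent map of the flow solves the variational equation `X' = J X`, and its compound solves
`(X^{(k)})' = J^{[k]} X^{(k)}`. Everything therefore reduces to one estimate, that in the inner
product scaled by `H = Q^{(k)}` the quadratic form of `J^{[k]}` is at most `-(η₁ + η₂) / 2`.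

*The estimate.* The multiplicative compound is the matrix of an exterior power, hence multiplicative
(`mulCompound_mul`), and the additive compound is its derivative at the identity, hence linear and
equivariant under conjugation (`addCompound_conj`). In the coordinates `w = H z` the Riccati
inequality bounds `Ã^{[k]}`, where `Ã = Q A Q⁻¹`, and the feedback contributes
`-(Xᵀ Y + Yᵀ X)^{[k]}` with `X = Bᵀ Q` and `Y = J_Φ C Q⁻¹`. Completing the square,
`-(Xᵀ Y + Yᵀ X) = Xᵀ X + Yᵀ Y - (X + Y)ᵀ (X + Y)`. The eigenvalues of the additive compound of a
symmetric matrix are the sums of `k` of its eigenvalues, so the compound of the last square is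
positive semidefinite, and the compound of `Yᵀ Y - Q⁻¹ Cᵀ C Q⁻¹`, the gain matrix, is at most `-η₂`;
what is left of `Xᵀ X + Yᵀ Y` is the term of the Riccati inequality
(`two_mul_dotProduct_addCompound_mulVec_le`).

*The matrix measure* exists because `ε ↦ ‖1 + ε M‖` is convex, and the expansion of
`|z + ε M z|²` bounds it by the quadratic form (`exists_isMatrixMeasure_le`).

*Contraction.* The flow is differentiable, with derivative the fundamental matrix of the
variational equation (`hasFDerivAt_flow`); the quadratic form of `J^{[k]}` bounds the logarithmic
derivative of the norm of `X^{(k)} z` (`isKContractive_of_dotProduct_le`).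
-/

noncomputable section

namespace Lurie

variable {n : ℕ}

/-! ### Multiplicative and additive compounds -/

/-- The basis of the `k`-th exterior power of `ℝⁿ` formed by the products `e_{i₁} ∧ ⋯ ∧ e_{i_k}` of
standard basis vectors, indexed by the increasing sequences that label compounds. -/
def wedgeBasis (k n : ℕ) : Module.Basis (KSub k n) ℝ (⋀[ℝ]^k (Fin n → ℝ)) :=
  ((Pi.basisFun ℝ (Fin n)).exteriorPower k).reindex
    (Equiv.subtypeEquivRight fun _ => Iff.rfl)

/-- The multiplicative compound is the matrix of the `k`-th exterior power of the linear map, so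
that the Cauchy–Binet formula is the functoriality of the exterior power. -/
theorem mulCompound_eq_toMatrix (k : ℕ) (A : Matrix (Fin n) (Fin n) ℝ) :
    mulCompound k A = LinearMap.toMatrix (wedgeBasis k n) (wedgeBasis k n)
      (exteriorPower.map k (Matrix.toLin' A)) := by
  ext α β
  rw [LinearMap.toMatrix_apply, wedgeBasis, Module.Basis.reindex_apply,
    Module.Basis.repr_reindex_apply, exteriorPower.basis_apply,
    exteriorPower.map_apply_ιMulti_family, exteriorPower.basis_repr_apply,
    exteriorPower.ιMulti_family, exteriorPower.ιMultiDual_apply_ιMulti, ← Matrix.det_transpose]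
  simp only [mulCompound, Matrix.of_apply]
  congr 1
  ext i j
  simp [Set.powersetCard.ofFinEmbEquiv_symm_apply]
  rfl

theorem mulCompound_mul (k : ℕ) (A B : Matrix (Fin n) (Fin n) ℝ) :
    mulCompound k (A * B) = mulCompound k A * mulCompound k B := by
  simp only [mulCompound_eq_toMatrix]
  rw [← LinearMap.toMatrix_comp, ← exteriorPower.map_comp, Matrix.toLin'_mul]

theorem mulCompound_one (k : ℕ) : mulCompound k (1 : Matrix (Fin n) (Fin n) ℝ) = 1 := by
  rw [mulCompound_eq_toMatrix, Matrix.toLin'_one, exteriorPower.map_id, LinearMap.toMatrix_id]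

theorem mulCompound_transpose (k : ℕ) (A : Matrix (Fin n) (Fin n) ℝ) :
    mulCompound k Aᵀ = (mulCompound k A)ᵀ := by
  ext α β
  simp only [mulCompound, Matrix.of_apply, Matrix.transpose_apply]
  rw [← Matrix.det_transpose]
  rfl

theorem differentiable_mulCompound_apply (k : ℕ) (α β : KSub k n) :
    Differentiable ℝ
      (fun M : Fin n → Fin n → ℝ => mulCompound k (Matrix.of M) α β) := by
  simp only [mulCompound, Matrix.of_apply, Matrix.det_apply, Matrix.submatrix_apply]
  fun_prop

theorem hasDerivAt_mulCompound_one_add_smul (k : ℕ) (A : Matrix (Fin n) (Fin n) ℝ)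
    (α β : KSub k n) :
    HasDerivAt (fun ε : ℝ => mulCompound k (1 + ε • A) α β) (addCompound k A α β) 0 := by
  have h : Differentiable ℝ (fun ε : ℝ => mulCompound k (1 + ε • A) α β) := by
    refine (differentiable_mulCompound_apply k α β).comp
      (f := fun (ε : ℝ) (i j : Fin n) => (1 + ε • A) i j) ?_
    simp only [Matrix.add_apply, Matrix.smul_apply]
    fun_prop
  exact (h 0).hasDerivAt

/-- The derivative of the compound along a line through the identity, read off from the Fréchet
derivative of its entries: it shows that `addCompound k` is linear. -/
theorem addCompound_apply_eq_fderiv (k : ℕ) (A : Matrix (Fin n) (Fin n) ℝ) (α β : KSub k n) :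
    addCompound k A α β =
      fderiv ℝ (fun M : Fin n → Fin n → ℝ => mulCompound k (Matrix.of M) α β)
        (fun i j => (1 : Matrix (Fin n) (Fin n) ℝ) i j) (fun i j => A i j) := by
  refine (hasDerivAt_mulCompound_one_add_smul k A α β).unique ?_
  have h1 : HasDerivAt (fun (ε : ℝ) (i j : Fin n) => (1 + ε • A) i j) (fun i j => A i j) 0 := by
    refine hasDerivAt_pi.2 fun i => hasDerivAt_pi.2 fun j => ?_
    simpa using ((hasDerivAt_id (0 : ℝ)).mul_const (A i j)).const_add ((1 : Matrix _ _ ℝ) i j)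
  have h2 := ((differentiable_mulCompound_apply k α β)
    (fun i j => (1 : Matrix (Fin n) (Fin n) ℝ) i j)).hasFDerivAt
  refine HasFDerivAt.comp_hasDerivAt (f := fun (ε : ℝ) (i j : Fin n) => (1 + ε • A) i j)
    (l := fun M : Fin n → Fin n → ℝ => mulCompound k (Matrix.of M) α β) (0 : ℝ) ?_ h1
  simpa using h2

theorem addCompound_add (k : ℕ) (A B : Matrix (Fin n) (Fin n) ℝ) :
    addCompound k (A + B) = addCompound k A + addCompound k B := by
  ext α β
  simp only [Matrix.add_apply, addCompound_apply_eq_fderiv]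
  exact map_add _ _ _

theorem addCompound_neg (k : ℕ) (A : Matrix (Fin n) (Fin n) ℝ) :
    addCompound k (-A) = -addCompound k A := by
  ext α β
  simp only [Matrix.neg_apply, addCompound_apply_eq_fderiv]
  exact map_neg _ _

theorem addCompound_sub (k : ℕ) (A B : Matrix (Fin n) (Fin n) ℝ) :
    addCompound k (A - B) = addCompound k A - addCompound k B := by
  rw [sub_eq_add_neg, addCompound_add, addCompound_neg, sub_eq_add_neg]

theorem addCompound_transpose (k : ℕ) (A : Matrix (Fin n) (Fin n) ℝ) :
    addCompound k Aᵀ = (addCompound k A)ᵀ := by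
  ext α β
  refine (hasDerivAt_mulCompound_one_add_smul k Aᵀ α β).unique ?_
  refine (hasDerivAt_mulCompound_one_add_smul k A β α).congr_of_eventuallyEq (.of_forall fun ε => ?_)
  have : 1 + ε • Aᵀ = (1 + ε • A)ᵀ := by simp
  simp only [this, mulCompound_transpose, Matrix.transpose_apply]

theorem addCompound_conj (k : ℕ) {U V : Matrix (Fin n) (Fin n) ℝ} (hUV : U * V = 1)
    (M : Matrix (Fin n) (Fin n) ℝ) :
    addCompound k (U * M * V) = mulCompound k U * addCompound k M * mulCompound k V := by
  ext α β
  refine (hasDerivAt_mulCompound_one_add_smul k _ α β).unique ?_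
  have h : ∀ ε : ℝ, mulCompound k (1 + ε • (U * M * V)) α β =
      ∑ x, (∑ y, mulCompound k U α y * mulCompound k (1 + ε • M) y x) * mulCompound k V x β := by
    intro ε
    have : 1 + ε • (U * M * V) = U * (1 + ε • M) * V := by
      rw [Matrix.mul_add, Matrix.add_mul, Matrix.mul_one, hUV]; simp
    rw [this, mulCompound_mul, mulCompound_mul]
    simp [Matrix.mul_apply]
  simp only [h, Matrix.mul_apply]
  refine HasDerivAt.fun_sum fun x _ => HasDerivAt.mul_const ?_ _
  exact HasDerivAt.fun_sum fun y _ => (hasDerivAt_mulCompound_one_add_smul k M y x).const_mul _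

/-- If `X' = J X` then the compound `X^{(k)}` solves the linear equation with matrix `J^{[k]}`. No
invertibility of `X t` is needed: the derivative of the compound at `X t` in the direction `J (X t)`
is computed along the line `(1 + ε J) (X t)`, on which the compound is multiplicative. -/
theorem hasDerivWithinAt_mulCompound (k : ℕ) {X : ℝ → Matrix (Fin n) (Fin n) ℝ}
    {J : Matrix (Fin n) (Fin n) ℝ} {s : Set ℝ} {t : ℝ}
    (hX : ∀ i j, HasDerivWithinAt (fun τ => X τ i j) ((J * X t) i j) s t) (α β : KSub k n) :
    HasDerivWithinAt (fun τ => mulCompound k (X τ) α β)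
      ((addCompound k J * mulCompound k (X t)) α β) s t := by
  have hF := ((differentiable_mulCompound_apply k α β) (fun i j => X t i j)).hasFDerivAt
  have hX' : HasDerivWithinAt (fun (τ : ℝ) (i j : Fin n) => X τ i j)
      (fun i j => (J * X t) i j) s t :=
    hasDerivWithinAt_pi.2 fun i => hasDerivWithinAt_pi.2 fun j => hX i j
  have h1 := hF.comp_hasDerivWithinAt t hX'
  refine h1.congr_deriv ?_
  have h2 : HasDerivAt (fun ε : ℝ => mulCompound k ((1 + ε • J) * X t) α β)
      ((addCompound k J * mulCompound k (X t)) α β) 0 := by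
    simp only [mulCompound_mul, Matrix.mul_apply]
    exact HasDerivAt.fun_sum fun x _ => (hasDerivAt_mulCompound_one_add_smul k J α x).mul_const _
  symm
  refine h2.unique ?_
  have h3 : HasDerivAt (fun (ε : ℝ) (i j : Fin n) => ((1 + ε • J) * X t) i j)
      (fun i j => (J * X t) i j) 0 := by
    refine hasDerivAt_pi.2 fun i => hasDerivAt_pi.2 fun j => ?_
    simp only [Matrix.add_mul, Matrix.one_mul, Matrix.smul_mul, Matrix.add_apply,
      Matrix.smul_apply, smul_eq_mul]
    simpa using ((hasDerivAt_id (0 : ℝ)).mul_const ((J * X t) i j)).const_add (X t i j)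
  refine HasFDerivAt.comp_hasDerivAt
    (f := fun (ε : ℝ) (i j : Fin n) => ((1 + ε • J) * X t) i j)
    (l := fun M : Fin n → Fin n → ℝ => mulCompound k (Matrix.of M) α β) (0 : ℝ) ?_ h3
  simpa using hF

theorem mulCompound_diagonal (k : ℕ) (d : Fin n → ℝ) :
    mulCompound k (diagonal d) = diagonal fun α : KSub k n => ∏ i ∈ α.1, d i := by
  ext α β
  by_cases h : α = β
  · subst h
    simp only [mulCompound, Matrix.of_apply, Matrix.diagonal_apply_eq]
    rw [Matrix.submatrix_diagonal _ _ (α.1.orderEmbOfFin α.2).injective, Matrix.det_diagonal]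
    conv_rhs => rw [← Finset.image_orderEmbOfFin_univ α.1 α.2]
    rw [Finset.prod_image fun x _ y _ hxy => (α.1.orderEmbOfFin α.2).injective hxy]
    rfl
  · rw [Matrix.diagonal_apply_ne _ h]
    obtain ⟨i, hi, hi'⟩ : ∃ i ∈ α.1, i ∉ β.1 := by
      by_contra! hc
      exact h (Subtype.ext (Finset.eq_of_subset_of_card_le hc (by rw [α.2, β.2])))
    obtain ⟨a, rfl⟩ : ∃ a, α.1.orderEmbOfFin α.2 a = i := by
      have : i ∈ Set.range (α.1.orderEmbOfFin α.2) := by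
        rw [Finset.range_orderEmbOfFin]; exact hi
      exact this
    simp only [mulCompound, Matrix.of_apply]
    refine Matrix.det_eq_zero_of_row_eq_zero a fun j => ?_
    rw [Matrix.submatrix_apply, Matrix.diagonal_apply_ne]
    intro he
    exact hi' (he ▸ Finset.orderEmbOfFin_mem β.1 β.2 j)

theorem addCompound_diagonal (k : ℕ) (d : Fin n → ℝ) :
    addCompound k (diagonal d) = diagonal fun α : KSub k n => ∑ i ∈ α.1, d i := by
  ext α β
  refine (hasDerivAt_mulCompound_one_add_smul k _ α β).unique ?_
  have h : ∀ ε : ℝ, 1 + ε • diagonal d = diagonal fun i => 1 + ε * d i := by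
    intro ε
    rw [← Matrix.diagonal_one, ← Matrix.diagonal_smul, Matrix.diagonal_add]
    rfl
  simp only [h, mulCompound_diagonal]
  by_cases hαβ : α = β
  · subst hαβ
    simp only [Matrix.diagonal_apply_eq]
    have := HasDerivAt.fun_finsetProd (u := α.1) (f := fun i (ε : ℝ) => 1 + ε * d i)
      (f' := fun i => d i) (x := 0)
      (fun i _ => by simpa using ((hasDerivAt_id (0 : ℝ)).mul_const (d i)).const_add 1)
    simpa using this
  · simp only [Matrix.diagonal_apply_ne _ hαβ]
    exact hasDerivAt_const _ _

/-! ### Additive compounds of symmetric matrices -/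

theorem sum_le_sumLargestEigenvalues {k : ℕ} (hk : 1 ≤ k) (hkn : k ≤ n)
    {S : Matrix (Fin n) (Fin n) ℝ} (hS : S.IsHermitian) (α : KSub k n) :
    ∑ i ∈ α.1, hS.eigenvalues i ≤ sumLargestEigenvalues k S hS := by
  set σ : Fin n ≃ Fin (Fintype.card (Fin n)) :=
    (Fintype.equivOfCardEq (Fintype.card_fin _)).symm with hσ
  set T : Finset (Fin (Fintype.card (Fin n))) := α.1.map σ.toEmbedding with hT
  have hTsum : ∑ i ∈ α.1, hS.eigenvalues i = ∑ i ∈ T, hS.eigenvalues₀ i := by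
    rw [hT, Finset.sum_map]; rfl
  set I : Finset (Fin (Fintype.card (Fin n))) := Finset.univ.filter fun i => i.1 < k with hI
  have hN : Fintype.card (Fin n) = n := Fintype.card_fin n
  have hTcard : T.card = k := by rw [hT, Finset.card_map, α.2]
  have hIcard : I.card = k := by
    rw [hI, Fin.card_filter_val_lt, hN, min_eq_right hkn]
  -- The `k`-th largest eigenvalue separates the eigenvalues in `I` from the others.
  set c := hS.eigenvalues₀ ⟨k - 1, by omega⟩ with hc
  have key : ∑ i ∈ T, (hS.eigenvalues₀ i - c) ≤ ∑ i ∈ I, (hS.eigenvalues₀ i - c) := by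
    rw [← Finset.sum_ite_mem_eq T, ← Finset.sum_ite_mem_eq I]
    refine Finset.sum_le_sum fun i _ => ?_
    by_cases hi : i.1 < k
    · have h1 : c ≤ hS.eigenvalues₀ i :=
        hS.eigenvalues₀_antitone (Fin.le_def.2 (by simp only; omega))
      rw [if_pos (show i ∈ I by simp [hI, hi])]
      split_ifs <;> linarith
    · have h1 : hS.eigenvalues₀ i ≤ c :=
        hS.eigenvalues₀_antitone (Fin.le_def.2 (by simp only; omega))
      rw [if_neg (show i ∉ I by simp [hI, hi])]
      split_ifs <;> linarith
  simp only [Finset.sum_sub_distrib, Finset.sum_const, hTcard, hIcard] at key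
  rw [hTsum, sumLargestEigenvalues]
  linarith

/-- The quadratic form of the additive compound of a symmetric matrix, diagonalised: the compound of
an orthogonal diagonalising matrix is again orthogonal, and the eigenvalues of `S^{[k]}` are the sums
of `k` eigenvalues of `S`. -/
theorem exists_dotProduct_addCompound_mulVec (k : ℕ) {S : Matrix (Fin n) (Fin n) ℝ}
    (hS : S.IsHermitian) (w : KSub k n → ℝ) :
    ∃ v : KSub k n → ℝ, v ⬝ᵥ v = w ⬝ᵥ w ∧
      w ⬝ᵥ addCompound k S *ᵥ w = ∑ α : KSub k n, (∑ i ∈ α.1, hS.eigenvalues i) * v α ^ 2 := by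
  set U : Matrix (Fin n) (Fin n) ℝ := (hS.eigenvectorUnitary : Matrix (Fin n) (Fin n) ℝ) with hU
  have hUU : U * Uᵀ = 1 := by
    have := Unitary.coe_mul_star_self hS.eigenvectorUnitary
    rwa [Unitary.coe_star, Matrix.star_eq_conjTranspose,
      Matrix.conjTranspose_eq_transpose_of_trivial] at this
  have hspec : S = U * diagonal hS.eigenvalues * Uᵀ := by
    have := hS.spectral_theorem
    rw [Unitary.conjStarAlgAut_apply, Matrix.star_eq_conjTranspose,
      Matrix.conjTranspose_eq_transpose_of_trivial] at this
    exact this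
  have hC : mulCompound k U * (mulCompound k U)ᵀ = 1 := by
    rw [← mulCompound_transpose, ← mulCompound_mul, hUU, mulCompound_one]
  have hadd : addCompound k S = mulCompound k U * addCompound k (diagonal hS.eigenvalues) *
      (mulCompound k U)ᵀ := by
    conv_lhs => rw [hspec]
    rw [addCompound_conj k hUU, mulCompound_transpose]
  refine ⟨(mulCompound k U)ᵀ *ᵥ w, ?_, ?_⟩
  · rw [Matrix.dotProduct_mulVec, Matrix.vecMul_mulVec, Matrix.transpose_transpose, hC,
      Matrix.vecMul_one]
  · rw [hadd, addCompound_diagonal, ← Matrix.mulVec_mulVec, ← Matrix.mulVec_mulVec,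
      Matrix.dotProduct_mulVec, ← Matrix.mulVec_transpose]
    simp only [dotProduct, Matrix.mulVec_diagonal]
    exact Finset.sum_congr rfl fun α _ => by ring

theorem dotProduct_addCompound_mulVec_le {k : ℕ} (hk : 1 ≤ k) (hkn : k ≤ n)
    {S : Matrix (Fin n) (Fin n) ℝ} (hS : S.IsHermitian) (w : KSub k n → ℝ) :
    w ⬝ᵥ addCompound k S *ᵥ w ≤ sumLargestEigenvalues k S hS * (w ⬝ᵥ w) := by
  obtain ⟨v, hv, hw⟩ := exists_dotProduct_addCompound_mulVec k hS w
  rw [hw, ← hv, dotProduct, Finset.mul_sum]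
  refine Finset.sum_le_sum fun α _ => ?_
  rw [← sq]
  exact mul_le_mul_of_nonneg_right (sum_le_sumLargestEigenvalues hk hkn hS α) (sq_nonneg _)

theorem dotProduct_addCompound_mulVec_nonneg (k : ℕ) {S : Matrix (Fin n) (Fin n) ℝ}
    (hS : S.PosSemidef) (w : KSub k n → ℝ) : 0 ≤ w ⬝ᵥ addCompound k S *ᵥ w := by
  obtain ⟨v, -, hw⟩ := exists_dotProduct_addCompound_mulVec k hS.1 w
  rw [hw]
  exact Finset.sum_nonneg fun α _ =>
    mul_nonneg (Finset.sum_nonneg fun i _ => hS.eigenvalues_nonneg i) (sq_nonneg _)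

/-! ### The decay inequality -/

theorem dotProduct_transpose_mulVec {ι : Type*} [Fintype ι] (M : Matrix ι ι ℝ) (w : ι → ℝ) :
    w ⬝ᵥ Mᵀ *ᵥ w = w ⬝ᵥ M *ᵥ w := by
  rw [Matrix.dotProduct_mulVec, Matrix.vecMul_transpose, dotProduct_comm]

theorem mulCompound_nonsing_inv_mul (k : ℕ) {Q : Matrix (Fin n) (Fin n) ℝ} (hQ : Q.PosDef) :
    mulCompound k Q⁻¹ * mulCompound k Q = 1 := by
  rw [← mulCompound_mul, Matrix.nonsing_inv_mul _ ((Matrix.isUnit_iff_isUnit_det _).1 hQ.isUnit),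
    mulCompound_one]

theorem mulCompound_mul_nonsing_inv (k : ℕ) {Q : Matrix (Fin n) (Fin n) ℝ} (hQ : Q.PosDef) :
    mulCompound k Q * mulCompound k Q⁻¹ = 1 := by
  rw [← mulCompound_mul, Matrix.mul_nonsing_inv _ ((Matrix.isUnit_iff_isUnit_det _).1 hQ.isUnit),
    mulCompound_one]

/-- The Riccati inequality in the coordinates `w = Q^{(k)} z`, in which `P^{(k)}` becomes the
identity and `A` becomes `Q A Q⁻¹`. -/
theorem riccati_dotProduct_le (k : ℕ) {Q : Matrix (Fin n) (Fin n) ℝ} (hQ : Q.PosDef)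
    (A U V : Matrix (Fin n) (Fin n) ℝ) (η : ℝ)
    (h : (-(mulCompound k (Q * Q) * addCompound k A
        + (addCompound k A)ᵀ * mulCompound k (Q * Q)
        + η • mulCompound k (Q * Q)
        + mulCompound k Q * (addCompound k U + addCompound k V) * mulCompound k Q)).PosSemidef)
    (w : KSub k n → ℝ) :
    2 * (w ⬝ᵥ addCompound k (Q * A * Q⁻¹) *ᵥ w) + η * (w ⬝ᵥ w)
      + w ⬝ᵥ addCompound k U *ᵥ w + w ⬝ᵥ addCompound k V *ᵥ w ≤ 0 := by
  have hQT : Qᵀ = Q := by simpa using hQ.1.eq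
  have hQinv : Q * Q⁻¹ = 1 :=
    Matrix.mul_nonsing_inv _ ((Matrix.isUnit_iff_isUnit_det _).1 hQ.isUnit)
  set H := mulCompound k Q with hH
  set G := mulCompound k Q⁻¹ with hG
  have hHT : Hᵀ = H := by rw [hH, ← mulCompound_transpose, hQT]
  have hGT : Gᵀ = G := by
    rw [hG, ← mulCompound_transpose, Matrix.transpose_nonsing_inv, hQT]
  have hGH : G * H = 1 := mulCompound_nonsing_inv_mul k hQ
  have hHG : H * G = 1 := mulCompound_mul_nonsing_inv k hQ
  have hA : addCompound k (Q * A * Q⁻¹) = H * addCompound k A * G := addCompound_conj k hQinv A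
  have h2 := h.conjTranspose_mul_mul_same G
  rw [Matrix.conjTranspose_eq_transpose_of_trivial, hGT] at h2
  have h3 : G * -(mulCompound k (Q * Q) * addCompound k A
        + (addCompound k A)ᵀ * mulCompound k (Q * Q)
        + η • mulCompound k (Q * Q)
        + H * (addCompound k U + addCompound k V) * H) * G =
      -(addCompound k (Q * A * Q⁻¹) + (addCompound k (Q * A * Q⁻¹))ᵀ + η • 1
        + (addCompound k U + addCompound k V)) := by
    rw [mulCompound_mul, ← hH, hA, Matrix.transpose_mul, Matrix.transpose_mul, hHT, hGT]
    have e1 : G * (H * H * addCompound k A) * G = H * addCompound k A * G := by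
      rw [← Matrix.mul_assoc, ← Matrix.mul_assoc, hGH, Matrix.one_mul]
    have e2 : G * ((addCompound k A)ᵀ * (H * H)) * G = G * ((addCompound k A)ᵀ * H) := by
      simp only [Matrix.mul_assoc]; rw [hHG, Matrix.mul_one]
    have e3 : G * (H * H) * G = 1 := by
      rw [← Matrix.mul_assoc, hGH, Matrix.one_mul, hHG]
    have e4 : ∀ M, G * (H * M * H) * G = M := by
      intro M
      rw [Matrix.mul_assoc H, ← Matrix.mul_assoc G, hGH, Matrix.one_mul, Matrix.mul_assoc, hHG,
        Matrix.mul_one]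
    rw [Matrix.mul_neg, Matrix.neg_mul, Matrix.mul_add, Matrix.mul_add, Matrix.mul_add,
      Matrix.add_mul, Matrix.add_mul, Matrix.add_mul, e1, e2, e4, Matrix.mul_smul,
      Matrix.smul_mul, e3]
  rw [h3] at h2
  have h4 := h2.dotProduct_mulVec_nonneg w
  simp only [star_trivial, Matrix.neg_mulVec, Matrix.add_mulVec, Matrix.smul_mulVec,
    Matrix.one_mulVec, dotProduct_neg, dotProduct_add, dotProduct_smul, smul_eq_mul,
    dotProduct_transpose_mulVec] at h4
  linarith

/-- The decay inequality in the coordinates `w = Q^{(k)} z`. With `X = Bᵀ Q` and `Y = G C Q⁻¹`, the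
feedback enters through `-(Xᵀ Y + Yᵀ X) = Xᵀ X + Yᵀ Y - (X + Y)ᵀ (X + Y)`, and the additive compound
of the last square is positive semidefinite. -/
theorem two_mul_dotProduct_addCompound_mulVec_le {m q k : ℕ} (hk : 1 ≤ k) (hkn : k ≤ n)
    {Q : Matrix (Fin n) (Fin n) ℝ} (hQ : Q.PosDef)
    (A : Matrix (Fin n) (Fin n) ℝ) (B : Matrix (Fin n) (Fin m) ℝ)
    (C : Matrix (Fin q) (Fin n) ℝ) (G : Matrix (Fin m) (Fin q) ℝ) (η₁ η₂ : ℝ)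
    (hRiccati : (-(mulCompound k (Q * Q) * addCompound k A
        + (addCompound k A)ᵀ * mulCompound k (Q * Q)
        + η₁ • mulCompound k (Q * Q)
        + mulCompound k Q
          * (addCompound k (Q * B * Bᵀ * Q) + addCompound k (Q⁻¹ * Cᵀ * C * Q⁻¹))
          * mulCompound k Q)).PosSemidef)
    (hGain : sumLargestEigenvalues k (gainMatrix Q C G) (gainMatrix_isHermitian hQ C G) ≤ -η₂)
    (w : KSub k n → ℝ) :
    2 * (w ⬝ᵥ addCompound k (Q * (A - B * G * C) * Q⁻¹) *ᵥ w) ≤ -(η₁ + η₂) * (w ⬝ᵥ w) := by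
  have hQT : Qᵀ = Q := by simpa using hQ.1.eq
  have hQIT : (Q⁻¹)ᵀ = Q⁻¹ := by rw [Matrix.transpose_nonsing_inv, hQT]
  have h1 := riccati_dotProduct_le k hQ A _ _ η₁ hRiccati w
  have h2 := dotProduct_addCompound_mulVec_le hk hkn (gainMatrix_isHermitian hQ C G) w
  have hww : 0 ≤ w ⬝ᵥ w := by simpa using dotProduct_star_self_nonneg w
  have h3 := mul_le_mul_of_nonneg_right hGain hww
  set W := Q * (B * G * C) * Q⁻¹ with hW
  set X := Bᵀ * Q with hX
  set Y := G * C * Q⁻¹ with hY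
  have h4 : 0 ≤ w ⬝ᵥ addCompound k ((X + Y)ᵀ * (X + Y)) *ᵥ w := by
    refine dotProduct_addCompound_mulVec_nonneg k ?_ w
    simpa using Matrix.posSemidef_conjTranspose_mul_self (X + Y)
  have e1 : (X + Y)ᵀ * (X + Y) = Q * B * Bᵀ * Q +
      (gainMatrix Q C G + Q⁻¹ * Cᵀ * C * Q⁻¹) + W + Wᵀ := by
    have ea : Xᵀ * X = Q * B * Bᵀ * Q := by
      simp only [hX, Matrix.transpose_mul, Matrix.transpose_transpose, hQT, Matrix.mul_assoc]
    have eb : Yᵀ * Y = gainMatrix Q C G + Q⁻¹ * Cᵀ * C * Q⁻¹ := by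
      simp only [hY, gainMatrix, Matrix.transpose_mul, hQIT, Matrix.mul_assoc, Matrix.mul_sub,
        Matrix.sub_mul, Matrix.one_mul, sub_add_cancel]
    have ec : Xᵀ * Y = W := by
      simp only [hX, hY, hW, Matrix.transpose_mul, Matrix.transpose_transpose, hQT,
        Matrix.mul_assoc]
    have ed : Yᵀ * X = Wᵀ := by
      rw [← ec, Matrix.transpose_mul Xᵀ Y, Matrix.transpose_transpose]
    rw [Matrix.transpose_add, Matrix.add_mul, Matrix.mul_add, Matrix.mul_add, ea, eb, ec, ed]
    abel
  rw [e1] at h4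
  simp only [addCompound_add, addCompound_transpose, Matrix.add_mulVec, dotProduct_add,
    dotProduct_transpose_mulVec] at h4
  rw [Matrix.mul_sub, Matrix.sub_mul, ← hW, addCompound_sub, Matrix.sub_mulVec, dotProduct_sub]
  linarith

/-- The decay inequality in the original coordinates of `k`-vectors. -/
theorem two_mul_dotProduct_mulCompound_mulVec_le {k : ℕ} {Q M : Matrix (Fin n) (Fin n) ℝ}
    (hQ : Q.PosDef) {c : ℝ}
    (h : ∀ w : KSub k n → ℝ, 2 * (w ⬝ᵥ addCompound k (Q * M * Q⁻¹) *ᵥ w) ≤ -c * (w ⬝ᵥ w))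
    (z : KSub k n → ℝ) :
    2 * ((mulCompound k Q *ᵥ z) ⬝ᵥ (mulCompound k Q *ᵥ (addCompound k M *ᵥ z))) ≤
      -c * ((mulCompound k Q *ᵥ z) ⬝ᵥ (mulCompound k Q *ᵥ z)) := by
  have hQinv : Q * Q⁻¹ = 1 :=
    Matrix.mul_nonsing_inv _ ((Matrix.isUnit_iff_isUnit_det _).1 hQ.isUnit)
  have := h (mulCompound k Q *ᵥ z)
  rwa [addCompound_conj k hQinv, Matrix.mulVec_mulVec, Matrix.mul_assoc,
    mulCompound_nonsing_inv_mul k hQ, Matrix.mul_one, ← Matrix.mulVec_mulVec] at this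

/-! ### Scaled norms and their matrix measures -/

section ScaledNorm

variable {ι : Type} [Fintype ι]

theorem l2Norm_eq_norm (z : ι → ℝ) : l2Norm z = ‖(WithLp.toLp 2 z : EuclideanSpace ℝ ι)‖ := by
  rw [l2Norm, EuclideanSpace.norm_eq]
  simp [dotProduct, sq]

theorem scaledNorm_eq_norm (H : Matrix ι ι ℝ) (z : ι → ℝ) :
    scaledNorm H z = ‖(WithLp.toLp 2 (H *ᵥ z) : EuclideanSpace ℝ ι)‖ := l2Norm_eq_norm _

theorem scaledNorm_nonneg (H : Matrix ι ι ℝ) (z : ι → ℝ) : 0 ≤ scaledNorm H z :=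
  Real.sqrt_nonneg _

theorem scaledNorm_sq (H : Matrix ι ι ℝ) (z : ι → ℝ) :
    scaledNorm H z ^ 2 = (H *ᵥ z) ⬝ᵥ (H *ᵥ z) :=
  Real.sq_sqrt (by simpa using dotProduct_star_self_nonneg (H *ᵥ z))

theorem scaledNorm_add_le (H : Matrix ι ι ℝ) (y z : ι → ℝ) :
    scaledNorm H (y + z) ≤ scaledNorm H y + scaledNorm H z := by
  simp only [scaledNorm_eq_norm, Matrix.mulVec_add, WithLp.toLp_add]
  exact norm_add_le _ _

theorem scaledNorm_smul (H : Matrix ι ι ℝ) (c : ℝ) (z : ι → ℝ) :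
    scaledNorm H (c • z) = |c| * scaledNorm H z := by
  simp only [scaledNorm_eq_norm, Matrix.mulVec_smul, WithLp.toLp_smul, norm_smul,
    Real.norm_eq_abs]

variable [DecidableEq ι]

theorem exists_scaledNorm_mulVec_le {H H' : Matrix ι ι ℝ} (hH : H' * H = 1) (M : Matrix ι ι ℝ) :
    ∃ K : ℝ, 0 ≤ K ∧ ∀ z, scaledNorm H (M *ᵥ z) ≤ K * scaledNorm H z := by
  refine ⟨‖Matrix.toEuclideanCLM (𝕜 := ℝ) (H * M * H')‖, norm_nonneg _, fun z => ?_⟩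
  have h := (Matrix.toEuclideanCLM (𝕜 := ℝ) (H * M * H')).le_opNorm (WithLp.toLp 2 (H *ᵥ z))
  rw [Matrix.toEuclideanCLM_toLp, Matrix.mulVec_mulVec, Matrix.mul_assoc, hH, Matrix.mul_one,
    ← Matrix.mulVec_mulVec] at h
  simpa only [scaledNorm_eq_norm] using h

theorem exists_scaledNorm_eq_one [Nonempty ι] {H H' : Matrix ι ι ℝ} (hH : H * H' = 1) :
    ∃ z, scaledNorm H z = 1 := by
  let i : ι := Classical.arbitrary ι
  refine ⟨H' *ᵥ Pi.single i 1, ?_⟩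
  rw [scaledNorm, Matrix.mulVec_mulVec, hH, Matrix.one_mulVec]
  simp [l2Norm]

/-- The matrix measure of a scaled `L₂` norm exists because `ε ↦ ‖1 + ε M‖` is convex, so that its
difference quotient at `0` is monotone; and it is at most `-c` once `-c` dominates the quadratic form
of `M` in the scaled inner product. -/
theorem exists_isMatrixMeasure_le [Nonempty ι] {H H' M : Matrix ι ι ℝ}
    (hHH' : H * H' = 1) (hH'H : H' * H = 1) {c : ℝ}
    (hc : ∀ z, (H *ᵥ z) ⬝ᵥ (H *ᵥ (M *ᵥ z)) ≤ -c * ((H *ᵥ z) ⬝ᵥ (H *ᵥ z))) :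
    ∃ μ : ℝ, IsMatrixMeasure (scaledNorm H) M μ ∧ μ ≤ -c := by
  obtain ⟨K, hK, hMK⟩ := exists_scaledNorm_mulVec_le hH'H M
  obtain ⟨z₀, hz₀⟩ := exists_scaledNorm_eq_one hHH'
  set N := scaledNorm H with hN
  have hmul : ∀ (ε : ℝ) z, (1 + ε • M) *ᵥ z = z + ε • (M *ᵥ z) := fun ε z => by
    rw [Matrix.add_mulVec, Matrix.one_mulVec, Matrix.smul_mulVec]
  have hbdd : ∀ ε : ℝ, BddAbove {r : ℝ | ∃ z, N z = 1 ∧ r = N ((1 + ε • M) *ᵥ z)} := by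
    rintro ε
    refine ⟨1 + |ε| * K, ?_⟩
    rintro _ ⟨z, hz, rfl⟩
    rw [hmul]
    refine (scaledNorm_add_le H _ _).trans ?_
    rw [scaledNorm_smul]
    have := hMK z
    rw [hz, mul_one] at this
    exact add_le_add hz.le (mul_le_mul_of_nonneg_left this (abs_nonneg _))
  have hle : ∀ (ε : ℝ) z, N z = 1 → N (z + ε • (M *ᵥ z)) ≤ inducedNorm N (1 + ε • M) :=
    fun ε z hz => le_csSup (hbdd ε) ⟨z, hz, by rw [hmul]⟩
  have hsup : ∀ (ε b : ℝ), (∀ z, N z = 1 → N (z + ε • (M *ᵥ z)) ≤ b) →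
      inducedNorm N (1 + ε • M) ≤ b := by
    intro ε b h
    refine csSup_le ⟨_, z₀, hz₀, rfl⟩ ?_
    rintro _ ⟨z, hz, rfl⟩
    rw [hmul]
    exact h z hz
  set g : ℝ → ℝ := fun ε => (inducedNorm N (1 + ε • M) - 1) / ε with hg
  have hmono : MonotoneOn g (Set.Ioi 0) := by
    intro s hs t ht hst
    have hs : 0 < s := hs
    have ht : 0 < t := ht
    have h1 : inducedNorm N (1 + s • M) ≤ (1 - s / t) + s / t * inducedNorm N (1 + t • M) := by
      refine hsup s _ fun z hz => ?_
      have e : z + s • (M *ᵥ z) = (1 - s / t) • z + (s / t) • (z + t • (M *ᵥ z)) := by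
        rw [smul_add, smul_smul, div_mul_cancel₀ _ ht.ne', sub_smul, one_smul]
        abel
      have hst' : s / t ≤ 1 := (div_le_one ht).2 hst
      have hst0 : 0 ≤ s / t := by positivity
      rw [e]
      refine (scaledNorm_add_le H _ _).trans ?_
      rw [scaledNorm_smul, scaledNorm_smul, abs_of_nonneg (by linarith), abs_of_nonneg hst0,
        ← hN, hz, mul_one]
      gcongr
      exact hle t z hz
    have h2 : inducedNorm N (1 + s • M) - 1 ≤ s * ((inducedNorm N (1 + t • M) - 1) / t) := by
      calc _ ≤ (1 - s / t) + s / t * inducedNorm N (1 + t • M) - 1 := by linarith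
        _ = _ := by field_simp; ring
    simp only [hg]
    rw [div_le_iff₀ hs]
    linarith
  have hbelow : BddBelow (g '' Set.Ioi 0) := by
    refine ⟨-K, ?_⟩
    rintro _ ⟨s, hs, rfl⟩
    have hs : 0 < s := hs
    simp only [hg]
    rw [le_div_iff₀ hs]
    have h1 := hle s z₀ hz₀
    have h2 : N z₀ ≤ N (z₀ + s • (M *ᵥ z₀)) + s * N (M *ᵥ z₀) := by
      have := scaledNorm_add_le H (z₀ + s • (M *ᵥ z₀)) ((-s) • (M *ᵥ z₀))
      rwa [scaledNorm_smul, abs_neg, abs_of_pos hs, neg_smul, add_neg_cancel_right] at this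
    have h3 := mul_le_mul_of_nonneg_left (hMK z₀) hs.le
    rw [hz₀] at h2 h3
    linarith
  have hlim := hmono.tendsto_nhdsGT hbelow
  refine ⟨_, hlim, ?_⟩
  have hup : Tendsto (fun ε : ℝ => -c + ε * K ^ 2 / 2) (𝓝[>] 0) (𝓝 (-c)) := by
    have : ContinuousAt (fun ε : ℝ => -c + ε * K ^ 2 / 2) 0 := by fun_prop
    simpa [ContinuousAt] using this.tendsto.mono_left (nhdsWithin_le_nhds (s := Set.Ioi 0))
  refine le_of_tendsto_of_tendsto hlim hup ?_
  filter_upwards [self_mem_nhdsWithin] with s hs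
  have hs : 0 < s := hs
  rw [div_le_iff₀ hs, sub_le_iff_le_add]
  refine hsup s _ fun z hz => ?_
  have hsq : N (z + s • (M *ᵥ z)) ^ 2 ≤ 1 - 2 * s * c + s ^ 2 * K ^ 2 := by
    have h1 := hc z
    have h2 : N (M *ᵥ z) ^ 2 ≤ K ^ 2 := by
      have := hMK z
      rw [hz, mul_one] at this
      exact pow_le_pow_left₀ (scaledNorm_nonneg _ _) this 2
    have h3 : N z ^ 2 = 1 := by rw [hz]; norm_num
    simp only [hN, scaledNorm_sq] at h2 h3 ⊢
    rw [h3] at h1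
    rw [Matrix.mulVec_add, Matrix.mulVec_smul, add_dotProduct, dotProduct_add, dotProduct_add,
      h3, smul_dotProduct, smul_dotProduct, dotProduct_smul, dotProduct_smul,
      dotProduct_comm (H *ᵥ (M *ᵥ z)) (H *ᵥ z)]
    simp only [smul_eq_mul]
    nlinarith [mul_le_mul_of_nonneg_left h1 hs.le,
      mul_le_mul_of_nonneg_left h2 (sq_nonneg s)]
  -- `x ≤ (1 + x²) / 2`
  nlinarith [sq_nonneg (N (z + s • (M *ᵥ z)) - 1)]

end ScaledNorm

/-! ### Linear equations and differentiability of the flow -/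

section Fence

variable {E : Type*} [NormedAddCommGroup E] [NormedSpace ℝ E]

/-- An exponential a priori bound. The derivative has to be estimated only where the bound is
attained, so that the estimate may use the bound itself. -/
theorem norm_le_mul_exp_of_hasDerivWithinAt {a b c K : ℝ} {u u' : ℝ → E}
    (hu : ∀ t ∈ Set.Icc a b, HasDerivWithinAt u (u' t) (Set.Icc a b) t) (h0 : ‖u a‖ ≤ c)
    (hbound : ∀ t ∈ Set.Icc a b, ‖u t‖ = c * Real.exp (K * (t - a)) →
      ‖u' t‖ < K * (c * Real.exp (K * (t - a)))) :
    ∀ t ∈ Set.Icc a b, ‖u t‖ ≤ c * Real.exp (K * (t - a)) := by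
  have hB : ∀ t : ℝ, HasDerivAt (fun s => c * Real.exp (K * (s - a)))
      (K * (c * Real.exp (K * (t - a)))) t := by
    intro t
    have h := ((((hasDerivAt_id t).sub_const a).const_mul K).exp).const_mul c
    refine h.congr_deriv ?_
    simp only [id]
    ring
  intro t ht
  exact image_norm_le_of_norm_deriv_right_lt_deriv_boundary
    (fun s hs => (hu s hs).continuousWithinAt)
    (fun s hs => (hu s (Set.Ico_subset_Icc_self hs)).mono_of_mem_nhdsWithin
      (Icc_mem_nhdsGE_of_mem hs))
    (by simpa using h0) hB (fun s hs => hbound s (Set.Ico_subset_Icc_self hs)) ht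

end Fence

/-- The retraction of `ℝⁿ` onto the cube `[-R, R]ⁿ` (for `0 ≤ R`), the closed ball of radius `R` of
the supremum norm. -/
def clamp (R : ℝ) (x : Fin n → ℝ) : Fin n → ℝ := fun i => max (-R) (min R (x i))

theorem lipschitzWith_clamp (R : ℝ) : LipschitzWith 1 (clamp R : (Fin n → ℝ) → Fin n → ℝ) := by
  refine LipschitzWith.of_dist_le_mul fun x y => ?_
  rw [NNReal.coe_one, one_mul, dist_pi_le_iff dist_nonneg]
  intro i
  refine le_trans ?_ (dist_le_pi_dist x y i)
  simp only [clamp, Real.dist_eq]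
  refine (abs_max_sub_max_le_max _ _ _ _).trans ?_
  rw [sub_self, abs_zero, max_eq_right (abs_nonneg _)]
  refine (abs_min_sub_min_le_max _ _ _ _).trans ?_
  rw [sub_self, abs_zero, max_eq_right (abs_nonneg _)]

theorem norm_clamp_le {R : ℝ} (hR : 0 ≤ R) (x : Fin n → ℝ) : ‖clamp R x‖ ≤ R :=
  (pi_norm_le_iff_of_nonneg hR).2 fun i =>
    abs_le.2 ⟨le_max_left _ _, max_le (by linarith) (min_le_left _ _)⟩

theorem norm_clamp_le_norm {R : ℝ} (hR : 0 ≤ R) (x : Fin n → ℝ) : ‖clamp R x‖ ≤ ‖x‖ := by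
  have h0 : clamp R (0 : Fin n → ℝ) = 0 := by
    funext i
    simp [clamp, hR]
  simpa [h0] using (lipschitzWith_clamp R).dist_le_mul x 0

theorem clamp_eq_self {R : ℝ} {x : Fin n → ℝ} (hx : ‖x‖ ≤ R) : clamp R x = x := by
  funext i
  have h := abs_le.1 ((norm_le_pi_norm x i).trans hx)
  simp only [clamp, min_eq_right h.2, max_eq_right h.1]

/-- A linear equation with continuous coefficients has solutions on the whole interval. The
Picard–Lindelöf theorem gives them for the equation truncated outside a large ball, whose right-hand
side is bounded, and the exponential bound shows that they never leave that ball. -/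
theorem exists_linear_solution {a b : ℝ} (hab : a ≤ b)
    {L : ℝ → (Fin n → ℝ) →L[ℝ] (Fin n → ℝ)} (hL : ContinuousOn L (Set.Icc a b))
    (v : Fin n → ℝ) :
    ∃ x : ℝ → Fin n → ℝ, x a = v ∧
      ∀ t ∈ Set.Icc a b, HasDerivWithinAt x (L t (x t)) (Set.Icc a b) t := by
  obtain ⟨K', hK'⟩ := isCompact_Icc.exists_bound_of_continuousOn hL
  set K : NNReal := K'.toNNReal
  have hK : ∀ t ∈ Set.Icc a b, ‖L t‖ ≤ K := fun t ht =>
    (hK' t ht).trans (Real.le_coe_toNNReal K')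
  set c : ℝ := ‖v‖ + 1
  have hc : 0 < c := by positivity
  set R : NNReal := ⟨c * Real.exp ((K + 1) * (b - a)), by positivity⟩
  have hR0 : (0 : ℝ) ≤ R := R.2
  have hPL : IsPicardLindelof (fun t x => L t (clamp R x)) ⟨a, Set.left_mem_Icc.2 hab⟩ v
      (K * R * ⟨b - a, by linarith⟩) 0 (K * R) K := by
    refine ⟨fun t ht => ?_, fun x _ => ?_, fun t ht x _ => ?_, ?_⟩
    · have h := ((L t).lipschitz.weaken (show ‖L t‖₊ ≤ K from hK t ht)).comp
        (lipschitzWith_clamp (n := n) R)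
      rw [mul_one] at h
      exact h.lipschitzOnWith
    · exact hL.clm_apply continuousOn_const
    · refine ((L t).le_opNorm _).trans ?_
      rw [NNReal.coe_mul]
      exact mul_le_mul (hK t ht) (norm_clamp_le hR0 x) (norm_nonneg _) K.2
    · rw [max_eq_left (by simpa using hab), NNReal.coe_zero, sub_zero]
      exact le_rfl
  obtain ⟨x, hxa, hx⟩ := hPL.exists_eq_forall_mem_Icc_hasDerivWithinAt₀
  refine ⟨x, hxa, fun t ht => ?_⟩
  have hbd := norm_le_mul_exp_of_hasDerivWithinAt (c := c) (K := K + 1) hx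
    (by change ‖x a‖ ≤ _; rw [show x a = v from hxa]; simp [c]) (fun s hs hsc => by
      have h1 : ‖L s (clamp R (x s))‖ ≤ K * ‖x s‖ :=
        ((L s).le_opNorm _).trans
          (mul_le_mul (hK s hs) (norm_clamp_le_norm hR0 _) (norm_nonneg _) K.2)
      rw [hsc] at h1
      have : 0 < c * Real.exp ((K + 1) * (s - a)) := by positivity
      linarith) t ht
  have hxR : ‖x t‖ ≤ R := by
    refine hbd.trans ?_
    change _ ≤ c * Real.exp ((K + 1) * (b - a))
    gcongr
    exact ht.2
  have := hx t ht
  rwa [clamp_eq_self hxR] at this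

theorem exists_fundamental_matrix {a b : ℝ} (hab : a ≤ b)
    {L : ℝ → (Fin n → ℝ) →L[ℝ] (Fin n → ℝ)} (hL : ContinuousOn L (Set.Icc a b)) :
    ∃ X : ℝ → Matrix (Fin n) (Fin n) ℝ, X a = 1 ∧ ∀ t ∈ Set.Icc a b, ∀ i j,
      HasDerivWithinAt (fun τ => X τ i j)
        ((LinearMap.toMatrix' (L t : (Fin n → ℝ) →ₗ[ℝ] (Fin n → ℝ)) * X t) i j)
        (Set.Icc a b) t := by
  choose x hxa hx using fun j : Fin n =>
    exists_linear_solution hab hL (Pi.single j (1 : ℝ))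
  refine ⟨fun t => Matrix.of fun i j => x j t i, ?_, fun t ht i j => ?_⟩
  · ext i j
    simp [hxa, Matrix.one_apply, Pi.single_apply]
  · refine ((hasDerivWithinAt_pi.1 (hx j t ht)) i).congr_deriv ?_
    have h : (LinearMap.toMatrix' (L t : (Fin n → ℝ) →ₗ[ℝ] (Fin n → ℝ))) *ᵥ x j t = L t (x j t) := by
      rw [LinearMap.toMatrix'_mulVec]; rfl
    rw [← h]
    rfl

/-- **Differentiable dependence on initial values.** The flow of a vector field with continuous
derivative `F` is differentiable at `x₀`, and its derivative is the fundamental matrix of the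
variational equation along the solution through `x₀`. -/
theorem hasFDerivAt_flow {a b : ℝ} {f : ℝ → (Fin n → ℝ) → (Fin n → ℝ)}
    {F : ℝ → (Fin n → ℝ) → (Fin n → ℝ) →L[ℝ] (Fin n → ℝ)}
    (hf : ∀ t ∈ Set.Icc a b, ∀ x, HasFDerivAt (f t) (F t x) x)
    (hF : ContinuousOn (fun p : ℝ × (Fin n → ℝ) => F p.1 p.2) (Set.Icc a b ×ˢ Set.univ))
    {φ : ℝ → (Fin n → ℝ) → (Fin n → ℝ)} {x₀ : Fin n → ℝ}
    (hφ : ∀ᶠ y in 𝓝 x₀, φ a y = y ∧ IsSolution f a b (fun t => φ t y))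
    {X : ℝ → Matrix (Fin n) (Fin n) ℝ} (hXa : X a = 1)
    (hX : ∀ t ∈ Set.Icc a b, ∀ i j, HasDerivWithinAt (fun τ => X τ i j)
        ((LinearMap.toMatrix' (F t (φ t x₀) : (Fin n → ℝ) →ₗ[ℝ] (Fin n → ℝ)) * X t) i j)
        (Set.Icc a b) t) :
    ∀ t ∈ Set.Icc a b,
      HasFDerivAt (φ t) (LinearMap.toContinuousLinearMap (Matrix.toLin' (X t))) x₀ := by
  intro t₁ ht₁
  have hab : a ≤ b := ht₁.1.trans ht₁.2
  obtain ⟨hx0, hxs⟩ := hφ.self_of_nhds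
  set x : ℝ → Fin n → ℝ := fun t => φ t x₀ with hx
  have hXv : ∀ v : Fin n → ℝ, ∀ t ∈ Set.Icc a b,
      HasDerivWithinAt (fun τ => X τ *ᵥ v) (F t (x t) (X t *ᵥ v)) (Set.Icc a b) t := by
    intro v t ht
    have h : F t (x t) (X t *ᵥ v) =
        (LinearMap.toMatrix' (F t (φ t x₀) : (Fin n → ℝ) →ₗ[ℝ] (Fin n → ℝ)) * X t) *ᵥ v := by
      rw [← Matrix.mulVec_mulVec, LinearMap.toMatrix'_mulVec]; rfl
    rw [h]
    refine hasDerivWithinAt_pi.2 fun i => ?_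
    simp only [Matrix.mulVec, dotProduct]
    exact HasDerivWithinAt.fun_sum fun j _ => (hX t ht i j).mul_const _
  have hxc : ContinuousOn x (Set.Icc a b) := fun t ht => (hxs t ht).continuousWithinAt
  obtain ⟨R, hR⟩ := isCompact_Icc.exists_bound_of_continuousOn hxc
  set D : Set (Fin n → ℝ) := Metric.closedBall 0 (R + 1) with hD
  have hcomp : IsCompact (Set.Icc a b ×ˢ D) := isCompact_Icc.prod (isCompact_closedBall _ _)
  have hFD := hF.mono (Set.prod_mono (Set.Subset.refl _) (Set.subset_univ D))
  obtain ⟨L', hL'⟩ := hcomp.exists_bound_of_continuousOn hFD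
  set L : ℝ := max L' 0
  have hL0 : 0 ≤ L := le_max_right _ _
  have hL : ∀ t ∈ Set.Icc a b, ∀ y ∈ D, ‖F t y‖ ≤ L := fun t ht y hy =>
    (hL' (t, y) ⟨ht, hy⟩).trans (le_max_left _ _)
  have hunif := hcomp.uniformContinuousOn_of_continuous hFD
  set c : ℝ := Real.exp ((L + 1) * (b - a)) with hc
  have hc0 : 0 < c := Real.exp_pos _
  have hexp : ∀ t ∈ Set.Icc a b, Real.exp ((L + 1) * (t - a)) ≤ c := by
    intro t ht
    rw [hc]
    gcongr
    exact ht.2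
  have hballD : ∀ t ∈ Set.Icc a b, ∀ y, ‖y - x t‖ ≤ 1 → y ∈ D := by
    intro t ht y hy
    rw [hD, mem_closedBall_zero_iff]
    have := norm_add_le (y - x t) (x t)
    rw [sub_add_cancel] at this
    linarith [hR t ht]
  have hxD : ∀ t ∈ Set.Icc a b, x t ∈ D := fun t ht => hballD t ht _ (by simp)
  refine HasFDerivAt.of_isLittleO (Asymptotics.isLittleO_iff.2 fun ε' hε' => ?_)
  set ε : ℝ := ε' / (2 * c ^ 2) with hε
  have hε0 : 0 < ε := by positivity
  obtain ⟨δ', hδ', hδF⟩ := Metric.uniformContinuousOn_iff.1 hunif ε hε0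
  set δ : ℝ := min δ' 1
  have hδ0 : 0 < δ := lt_min hδ' one_pos
  have hnear : ∀ᶠ y in 𝓝 x₀, ‖y - x₀‖ * c < δ := by
    have : ContinuousAt (fun y => ‖y - x₀‖ * c) x₀ := by fun_prop
    refine this.eventually_lt continuousAt_const ?_
    simpa using hδ0
  filter_upwards [hφ, hnear] with y hy hyδ
  rcases eq_or_ne y x₀ with rfl | hne
  · simp
  set r : ℝ := ‖y - x₀‖ with hr
  have hr0 : 0 < r := norm_pos_iff.2 (sub_ne_zero.2 hne)
  obtain ⟨hya, hys⟩ := hy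
  have hua : φ a y - x a = y - x₀ := by rw [hya, hx]; simp only [hx0]
  -- The solution through `y` stays `r c`-close to the one through `x₀`.
  have hclose : ∀ t ∈ Set.Icc a b, ‖φ t y - x t‖ ≤ r * Real.exp ((L + 1) * (t - a)) := by
    refine norm_le_mul_exp_of_hasDerivWithinAt (u := fun t => φ t y - x t)
      (fun t ht => (hys t ht).sub (hxs t ht)) (by simp only [hua]; exact le_refl _) ?_
    intro t ht heq
    have h1 : ‖φ t y - x t‖ ≤ 1 := by
      rw [heq]
      have := mul_le_mul_of_nonneg_left (hexp t ht) hr0.le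
      linarith [min_le_right δ' 1]
    have h2 : ‖f t (φ t y) - f t (x t)‖ ≤ L * ‖φ t y - x t‖ :=
      (convex_closedBall (0 : Fin n → ℝ) (R + 1)).norm_image_sub_le_of_norm_hasFDerivWithin_le
        (fun z _ => (hf t ht z).hasFDerivWithinAt) (fun z hz => hL t ht z hz)
        (hxD t ht) (hballD t ht _ h1)
    rw [heq] at h2
    have : 0 < r * Real.exp ((L + 1) * (t - a)) := by positivity
    change ‖f t (φ t y) - f t (x t)‖ < _
    linarith
  have hclose' : ∀ t ∈ Set.Icc a b, ‖φ t y - x t‖ ≤ r * c := fun t ht =>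
    (hclose t ht).trans (mul_le_mul_of_nonneg_left (hexp t ht) hr0.le)
  -- The linearisation error solves a perturbed linear equation with a forcing of size `ε c r`.
  have herr : ∀ t ∈ Set.Icc a b, ‖(φ t y - x t) - X t *ᵥ (y - x₀)‖ ≤
      (2 * (ε * (r * c))) * Real.exp ((L + 1) * (t - a)) := by
    refine norm_le_mul_exp_of_hasDerivWithinAt
      (u := fun t => (φ t y - x t) - X t *ᵥ (y - x₀))
      (fun t ht => ((hys t ht).sub (hxs t ht)).sub (hXv (y - x₀) t ht)) ?_ ?_
    · simp only [hua, hXa, Matrix.one_mulVec, sub_self, norm_zero]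
      positivity
    · intro t ht heq
      have h1 : ‖f t (φ t y) - f t (x t) - F t (x t) (φ t y - x t)‖ ≤ ε * ‖φ t y - x t‖ := by
        refine (convex_ball (x t) δ).norm_image_sub_le_of_norm_hasFDerivWithin_le'
          (fun z _ => (hf t ht z).hasFDerivWithinAt) (fun z hz => ?_)
          (Metric.mem_ball_self hδ0) ?_
        · have hz' : dist z (x t) < δ := hz
          have hzD : z ∈ D := hballD t ht z (by
            rw [← dist_eq_norm]; exact hz'.le.trans (min_le_right _ _))
          have := hδF (t, z) ⟨ht, hzD⟩ (t, x t) ⟨ht, hxD t ht⟩ (by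
            rw [Prod.dist_eq, dist_self, max_eq_right dist_nonneg]
            exact hz'.trans_le (min_le_left _ _))
          rw [dist_eq_norm] at this
          exact this.le
        · rw [Metric.mem_ball, dist_eq_norm]
          exact (hclose' t ht).trans_lt hyδ
      have h2 := (F t (x t)).le_opNorm ((φ t y - x t) - X t *ᵥ (y - x₀))
      have h3 := mul_le_mul_of_nonneg_right (hL t ht _ (hxD t ht))
        (norm_nonneg ((φ t y - x t) - X t *ᵥ (y - x₀)))
      have h4 : f t (φ t y) - f t (x t) - F t (x t) (X t *ᵥ (y - x₀)) =
          (f t (φ t y) - f t (x t) - F t (x t) (φ t y - x t)) +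
            F t (x t) ((φ t y - x t) - X t *ᵥ (y - x₀)) := by
        rw [map_sub _ (φ t y - x t)]; abel
      have h5 := mul_le_mul_of_nonneg_left (hclose' t ht) hε0.le
      have h6 : 1 ≤ Real.exp ((L + 1) * (t - a)) := by
        rw [Real.one_le_exp_iff]
        exact mul_nonneg (by linarith) (by linarith [ht.1])
      have h7 : 0 < ε * (r * c) := by positivity
      have h8 := mul_le_mul_of_nonneg_left h6 h7.le
      change ‖f t (φ t y) - f t (x t) - F t (x t) (X t *ᵥ (y - x₀))‖ < _
      rw [h4]
      refine (norm_add_le _ _).trans_lt ?_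
      rw [heq] at h2 h3
      linarith
  have h := (herr t₁ ht₁).trans
    (mul_le_mul_of_nonneg_left (hexp t₁ ht₁) (by positivity))
  have e : 2 * (ε * (r * c)) * c = ε' * r := by rw [hε]; field_simp
  rw [e] at h
  exact h

/-! ### The closed-loop system -/

section ClosedLoop

variable {m q : ℕ} (A : Matrix (Fin n) (Fin n) ℝ) (B : Matrix (Fin n) (Fin m) ℝ)
  (C : Matrix (Fin q) (Fin n) ℝ) {Φ : ℝ → (Fin q → ℝ) → (Fin m → ℝ)}

theorem hasFDerivAt_closedLoop (hΦ : IsContDiffInState Φ) {t : ℝ} (ht : 0 ≤ t) (x : Fin n → ℝ) :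
    HasFDerivAt (closedLoop A B C Φ t)
      (A.toLin'.toContinuousLinearMap - B.toLin'.toContinuousLinearMap ∘L
        fderiv ℝ (Φ t) (C *ᵥ x) ∘L C.toLin'.toContinuousLinearMap) x := by
  have hC : HasFDerivAt (fun x : Fin n → ℝ => C *ᵥ x) C.toLin'.toContinuousLinearMap x :=
    C.toLin'.toContinuousLinearMap.hasFDerivAt
  have hA : HasFDerivAt (fun x : Fin n → ℝ => A *ᵥ x) A.toLin'.toContinuousLinearMap x :=
    A.toLin'.toContinuousLinearMap.hasFDerivAt
  have hP := (hΦ.2.1 t ht (C *ᵥ x)).hasFDerivAt.comp x hC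
  have hB : HasFDerivAt (fun x : Fin m → ℝ => B *ᵥ x) B.toLin'.toContinuousLinearMap
      (Φ t (C *ᵥ x)) := B.toLin'.toContinuousLinearMap.hasFDerivAt
  exact hA.sub (HasFDerivAt.comp (g := fun y : Fin m → ℝ => B *ᵥ y)
    (f := fun x : Fin n → ℝ => Φ t (C *ᵥ x)) x hB hP)

theorem jacobian_closedLoop (hΦ : IsContDiffInState Φ) {t : ℝ} (ht : 0 ≤ t) (x : Fin n → ℝ) :
    jacobian (closedLoop A B C Φ t) x = A - B * jacobian (Φ t) (C *ᵥ x) * C := by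
  rw [jacobian, (hasFDerivAt_closedLoop A B C hΦ ht x).fderiv, jacobian]
  apply Matrix.toLin'.injective
  rw [Matrix.toLin'_toMatrix', map_sub, Matrix.toLin'_mul, Matrix.toLin'_mul,
    Matrix.toLin'_toMatrix']
  rfl

theorem continuousOn_fderiv_closedLoop (hΦ : IsContDiffInState Φ) :
    ContinuousOn (fun p : ℝ × (Fin n → ℝ) => fderiv ℝ (closedLoop A B C Φ p.1) p.2)
      (Set.Ici 0 ×ˢ Set.univ) := by
  have h : ContinuousOn (fun p : ℝ × (Fin n → ℝ) => fderiv ℝ (Φ p.1) (C *ᵥ p.2))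
      (Set.Ici 0 ×ˢ Set.univ) := by
    refine hΦ.2.2.comp (f := fun p : ℝ × (Fin n → ℝ) => (p.1, C *ᵥ p.2)) ?_
      fun p hp => ⟨hp.1, Set.mem_univ _⟩
    have : Continuous fun p : ℝ × (Fin n → ℝ) => (p.1, C *ᵥ p.2) :=
      continuous_fst.prodMk (continuous_const.matrix_mulVec continuous_snd)
    exact this.continuousOn
  refine ContinuousOn.congr
    (f := fun p : ℝ × (Fin n → ℝ) => A.toLin'.toContinuousLinearMap -
      B.toLin'.toContinuousLinearMap ∘L
        fderiv ℝ (Φ p.1) (C *ᵥ p.2) ∘L C.toLin'.toContinuousLinearMap) ?_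
    fun p hp => (hasFDerivAt_closedLoop A B C hΦ hp.1 p.2).fderiv
  exact continuousOn_const.sub (continuousOn_const.clm_comp (h.clm_comp continuousOn_const))

end ClosedLoop

/-! ### Contraction of `k`-vectors along the flow -/

/-- If the quadratic form of `M t` in the inner product scaled by `H` is at most `-η`, then the
solutions of `ẇ = M(t) w` decay at the rate `η`, as `e^{2 η t} |w|²` does not increase. -/
theorem scaledNorm_le_exp_mul {ι : Type} [Fintype ι] {a b η : ℝ} {H : Matrix ι ι ℝ}
    {M : ℝ → Matrix ι ι ℝ} {w : ℝ → ι → ℝ}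
    (hw : ∀ t ∈ Set.Icc a b, HasDerivWithinAt w (M t *ᵥ w t) (Set.Icc a b) t)
    (hM : ∀ t ∈ Set.Icc a b, ∀ z,
      (H *ᵥ z) ⬝ᵥ (H *ᵥ (M t *ᵥ z)) ≤ -η * ((H *ᵥ z) ⬝ᵥ (H *ᵥ z))) :
    ∀ t ∈ Set.Icc a b, scaledNorm H (w t) ≤ Real.exp (-η * (t - a)) * scaledNorm H (w a) := by
  intro t₁ ht₁
  have hHw : ∀ t ∈ Set.Icc a b,
      HasDerivWithinAt (fun t => H *ᵥ w t) (H *ᵥ (M t *ᵥ w t)) (Set.Icc a b) t := by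
    intro t ht
    refine hasDerivWithinAt_pi.2 fun i => ?_
    simp only [Matrix.mulVec, dotProduct]
    exact HasDerivWithinAt.fun_sum fun j _ =>
      ((hasDerivWithinAt_pi.1 (hw t ht)) j).const_mul (H i j)
  have hV : ∀ t ∈ Set.Icc a b, HasDerivWithinAt (fun t => (H *ᵥ w t) ⬝ᵥ (H *ᵥ w t))
      (2 * ((H *ᵥ w t) ⬝ᵥ (H *ᵥ (M t *ᵥ w t)))) (Set.Icc a b) t := by
    intro t ht
    have h : HasDerivWithinAt (fun t => ∑ i, (H *ᵥ w t) i * (H *ᵥ w t) i)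
        (∑ i, ((H *ᵥ (M t *ᵥ w t)) i * (H *ᵥ w t) i + (H *ᵥ w t) i * (H *ᵥ (M t *ᵥ w t)) i))
        (Set.Icc a b) t :=
      HasDerivWithinAt.fun_sum fun i _ =>
        ((hasDerivWithinAt_pi.1 (hHw t ht)) i).mul ((hasDerivWithinAt_pi.1 (hHw t ht)) i)
    refine h.congr_deriv ?_
    rw [dotProduct, Finset.mul_sum]
    exact Finset.sum_congr rfl fun i _ => by ring
  have hE : ∀ t : ℝ, HasDerivAt (fun t => Real.exp (2 * η * (t - a)))
      (2 * η * Real.exp (2 * η * (t - a))) t := by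
    intro t
    refine ((((hasDerivAt_id t).sub_const a).const_mul (2 * η)).exp).congr_deriv ?_
    simp only [id]
    ring
  have hG := fun t ht => (hE t).hasDerivWithinAt.mul (hV t ht)
  have hanti : AntitoneOn
      (fun t => Real.exp (2 * η * (t - a)) * ((H *ᵥ w t) ⬝ᵥ (H *ᵥ w t))) (Set.Icc a b) := by
    refine antitoneOn_of_hasDerivWithinAt_nonpos (convex_Icc a b)
      (fun t ht => (hG t ht).continuousWithinAt)
      (fun t ht => (hG t (interior_subset ht)).mono interior_subset) fun t ht => ?_
    have h1 := mul_le_mul_of_nonneg_left (hM t (interior_subset ht) (w t))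
      (Real.exp_pos (2 * η * (t - a))).le
    nlinarith
  have h := hanti ⟨le_refl a, ht₁.1.trans ht₁.2⟩ ht₁ ht₁.1
  simp only [sub_self, mul_zero, Real.exp_zero, one_mul, ← scaledNorm_sq] at h
  have he : Real.exp (2 * η * (t₁ - a)) = Real.exp (η * (t₁ - a)) ^ 2 := by
    rw [← Real.exp_nat_mul]; congr 1; push_cast; ring
  rw [he, ← mul_pow] at h
  have h2 := (pow_le_pow_iff_left₀ (mul_nonneg (Real.exp_pos _).le (scaledNorm_nonneg H _))
    (scaledNorm_nonneg H _) two_ne_zero).1 h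
  rw [neg_mul, Real.exp_neg, inv_mul_eq_div, le_div_iff₀ (Real.exp_pos _)]
  linarith

/-- A time-varying system with continuous Jacobian is `k`-contractive as soon as the additive
compound of its Jacobian has a uniformly negative quadratic form in the inner product scaled
by `H`. -/
theorem isKContractive_of_dotProduct_le {f : ℝ → (Fin n → ℝ) → (Fin n → ℝ)}
    (hf : ∀ t, 0 ≤ t → Differentiable ℝ (f t))
    (hf' : ContinuousOn (fun p : ℝ × (Fin n → ℝ) => fderiv ℝ (f p.1) p.2)
      (Set.Ici 0 ×ˢ Set.univ))
    {k : ℕ} {η : ℝ} (hη : 0 < η) {H : Matrix (KSub k n) (KSub k n) ℝ}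
    (hH : ∀ t, 0 ≤ t → ∀ x z, (H *ᵥ z) ⬝ᵥ (H *ᵥ (addCompound k (jacobian (f t) x) *ᵥ z)) ≤
      -η * ((H *ᵥ z) ⬝ᵥ (H *ᵥ z))) :
    IsKContractive f k η (scaledNorm H) := by
  refine ⟨hη, fun t₀ t₁ h0 h01 φ x₀ hφ t ht => ?_⟩
  have hsub : Set.Icc t₀ t₁ ⊆ Set.Ici 0 := fun s hs => h0.trans hs.1
  have hxc : ContinuousOn (fun s => φ s x₀) (Set.Icc t₀ t₁) :=
    fun s hs => (hφ.self_of_nhds.2 s hs).continuousWithinAt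
  have hL : ContinuousOn (fun s => fderiv ℝ (f s) (φ s x₀)) (Set.Icc t₀ t₁) :=
    hf'.comp (f := fun s => (s, φ s x₀)) (continuousOn_id.prodMk hxc)
      fun s hs => ⟨hsub hs, Set.mem_univ _⟩
  obtain ⟨X, hX0, hX⟩ := exists_fundamental_matrix h01 hL
  have hfd := hasFDerivAt_flow (fun s hs x => (hf s (hsub hs) x).hasFDerivAt)
    (hf'.mono (Set.prod_mono hsub (Set.Subset.refl _))) hφ hX0 hX t ht
  refine ⟨hfd.differentiableAt, fun z => ?_⟩
  have hjac : jacobian (φ t) x₀ = X t := by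
    rw [jacobian, hfd.fderiv]
    exact LinearMap.toMatrix'_toLin' _
  have hw : ∀ s ∈ Set.Icc t₀ t₁, HasDerivWithinAt (fun s => mulCompound k (X s) *ᵥ z)
      (addCompound k (jacobian (f s) (φ s x₀)) *ᵥ (mulCompound k (X s) *ᵥ z))
      (Set.Icc t₀ t₁) s := by
    intro s hs
    rw [Matrix.mulVec_mulVec]
    refine hasDerivWithinAt_pi.2 fun α => ?_
    simp only [Matrix.mulVec, dotProduct]
    exact HasDerivWithinAt.fun_sum fun β _ =>
      (hasDerivWithinAt_mulCompound k (hX s hs) α β).mul_const _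
  have h := scaledNorm_le_exp_mul hw (fun s hs z => hH s (hsub hs) _ z) t ht
  rwa [hX0, mulCompound_one, Matrix.one_mulVec, ← hjac] at h

end Lurie

end

theorem theorem1 {n m q : ℕ} (k : ℕ) (hk : 1 ≤ k) (hkn : k ≤ n)
    (A : Matrix (Fin n) (Fin n) ℝ) (B : Matrix (Fin n) (Fin m) ℝ)
    (C : Matrix (Fin q) (Fin n) ℝ) (Φ : ℝ → (Fin q → ℝ) → (Fin m → ℝ))
    (hΦ : Lurie.IsContDiffInState Φ)
    (η₁ η₂ : ℝ) (P Q : Matrix (Fin n) (Fin n) ℝ) (hP : P = Q * Q) (hQ : Q.PosDef)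
    (hRiccati : (-(Lurie.mulCompound k P * Lurie.addCompound k A
        + (Lurie.addCompound k A)ᵀ * Lurie.mulCompound k P
        + η₁ • Lurie.mulCompound k P
        + Lurie.mulCompound k Q
          * (Lurie.addCompound k (Q * B * Bᵀ * Q) + Lurie.addCompound k (Q⁻¹ * Cᵀ * C * Q⁻¹))
          * Lurie.mulCompound k Q)).PosSemidef)
    (hGain : ∀ (t : ℝ) (y : Fin q → ℝ), 0 ≤ t →
      Lurie.sumLargestEigenvalues k (Lurie.gainMatrix Q C (Lurie.jacobian (Φ t) y))
        (Lurie.gainMatrix_isHermitian hQ C (Lurie.jacobian (Φ t) y)) ≤ -η₂) :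
    (∀ (t : ℝ) (x : Fin n → ℝ), 0 ≤ t →
      ∃ μ : ℝ,
        Lurie.IsMatrixMeasure (Lurie.scaledNorm (Lurie.mulCompound k Q))
          (Lurie.addCompound k (Lurie.jacobian (Lurie.closedLoop A B C Φ t) x)) μ ∧
        μ ≤ -(η₁ + η₂) / 2) ∧
    (0 < η₁ + η₂ →
      Lurie.IsKContractive (Lurie.closedLoop A B C Φ) k ((η₁ + η₂) / 2)
        (Lurie.scaledNorm (Lurie.mulCompound k Q))) := by
  subst hP
  have key : ∀ t, 0 ≤ t → ∀ (x : Fin n → ℝ) (z : Lurie.KSub k n → ℝ),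
      (Lurie.mulCompound k Q *ᵥ z) ⬝ᵥ (Lurie.mulCompound k Q *ᵥ
        (Lurie.addCompound k (Lurie.jacobian (Lurie.closedLoop A B C Φ t) x) *ᵥ z)) ≤
      -((η₁ + η₂) / 2) * ((Lurie.mulCompound k Q *ᵥ z) ⬝ᵥ (Lurie.mulCompound k Q *ᵥ z)) := by
    intro t ht x z
    rw [Lurie.jacobian_closedLoop A B C hΦ ht x]
    have h := Lurie.two_mul_dotProduct_mulCompound_mulVec_le hQ
      (Lurie.two_mul_dotProduct_addCompound_mulVec_le hk hkn hQ A B C _ η₁ η₂ hRiccati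
        (hGain t (C *ᵥ x) ht)) z
    linarith
  have hne : Nonempty (Lurie.KSub k n) := by
    obtain ⟨s, -, hs⟩ := Finset.exists_subset_card_eq
      (show k ≤ (Finset.univ : Finset (Fin n)).card by simpa using hkn)
    exact ⟨⟨s, hs⟩⟩
  refine ⟨fun t x ht => ?_, fun hη => ?_⟩
  · obtain ⟨μ, hμ, hle⟩ := Lurie.exists_isMatrixMeasure_le
      (Lurie.mulCompound_mul_nonsing_inv k hQ) (Lurie.mulCompound_nonsing_inv_mul k hQ)
      (key t ht x)
    exact ⟨μ, hμ, by linarith⟩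
  · exact Lurie.isKContractive_of_dotProduct_le
      (fun t ht x => (Lurie.hasFDerivAt_closedLoop A B C hΦ ht x).differentiableAt)
      (Lurie.continuousOn_fderiv_closedLoop A B C hΦ) (by linarith) key
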